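/- Let $n>k\ge 1$ be integers and let $\epsilon>0$. For real $a,b$ let $$f(z)=z^n+az^k+b\bar z^k-1=h(z)+\overline{g(z)},\qquad h(z)=z^n+az^k-1,\quad g(z)=bz^k .$$ If $f(z_0)=0$ and $|h'(z_0)|>|g'(z_0)|$, the order of the zero $z_0$ is the smallest $m\ge1$ with $h^{(m)}(z_0)\ne0$; if $f(z_0)=0$ and $|h'(z_0)|<|g'(z_0)|$, its order is $-m$, where $m\ge1$ is the smallest integer with $g^{(m)}(z_0)\ne0$; zeros with $|h'(z_0)|=|g'(z_0)|$ are called singular and have no order. Then there is a real number $b_0$, depending only on $n$, $k$ and $\epsilon$, such that for all $b>b_0$ and all $a$ with $$0<a<\left(\frac{n-k}{n+k}-\epsilon\right)b,$$ the function $f$ has only finitely many zeros in $\mathbb C$, none of them is singular, and $f$ has exactly $n+2k$ zeros counted with multiplicity, the multiplicity of a zero being the absolute value of its order. -/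

import Mathlib

open scoped ComplexConjugate

noncomputable section

/-- The complex-valued harmonic function `h + conj g` with analytic part `h` and
co-analytic part `conj g`. -/
def harmonicMap (h g : ℂ → ℂ) (z : ℂ) : ℂ := h z + conj (g z)

/-- The sense-preserving region of `h + conj g`. -/
def sensePreservingRegion (h g : ℂ → ℂ) : Set ℂ := {z | ‖deriv g z‖ < ‖deriv h z‖}

/-- The sense-reversing region of `h + conj g`. -/
def senseReversingRegion (h g : ℂ → ℂ) : Set ℂ := {z | ‖deriv h z‖ < ‖deriv g z‖}

/-- The critical curve of `h + conj g`. -/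
def criticalCurve (h g : ℂ → ℂ) : Set ℂ := {z | ‖deriv h z‖ = ‖deriv g z‖}

/-- The least `m ≥ 1` such that the `m`-th derivative of `u` does not vanish at `z`. -/
def firstNonvanishingDeriv (u : ℂ → ℂ) (z : ℂ) : ℕ :=
  sInf {m : ℕ | 1 ≤ m ∧ iteratedDeriv m u z ≠ 0}

open Classical in
/-- The order of `z` as a zero of `h + conj g`: positive in the sense-preserving region,
negative in the sense-reversing region. On the critical curve (singular zeros) the order is
not defined; the value `0` there is a placeholder. -/
def zeroOrder (h g : ℂ → ℂ) (z : ℂ) : ℤ :=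
  if z ∈ sensePreservingRegion h g then (firstNonvanishingDeriv h z : ℤ)
  else if z ∈ senseReversingRegion h g then -(firstNonvanishingDeriv g z : ℤ)
  else 0

/-- `h + conj g` has exactly `N` zeros in the plane, counted with multiplicity: there are
finitely many zeros, none of them is singular (so each one has an order), and the absolute
values of their orders add up to `N`. -/
def HasExactlyZeros (h g : ℂ → ℂ) (N : ℕ) : Prop :=
  ∃ hfin : {z : ℂ | harmonicMap h g z = 0}.Finite,
    (∀ z : ℂ, harmonicMap h g z = 0 → z ∉ criticalCurve h g) ∧
    ∑ z ∈ hfin.toFinset, (zeroOrder h g z).natAbs = N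

/-- The analytic part `z ^ n + a z ^ k - 1`. -/
def analyticPart (n k : ℕ) (a : ℝ) (z : ℂ) : ℂ := z ^ n + (a : ℂ) * z ^ k - 1

/-- The conjugate `b z ^ k` of the co-analytic part. -/
def coanalyticPart (k : ℕ) (b : ℝ) (z : ℂ) : ℂ := (b : ℂ) * z ^ k

/-- The two parts give `f(z) = z ^ n + a z ^ k + b (conj z) ^ k - 1`. -/
theorem harmonicMap_parts (n k : ℕ) (a b : ℝ) (z : ℂ) :
    harmonicMap (analyticPart n k a) (coanalyticPart k b) z =
      z ^ n + (a : ℂ) * z ^ k + (b : ℂ) * (conj z) ^ k - 1 := by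
  simp only [harmonicMap, analyticPart, coanalyticPart, map_mul, map_pow, Complex.conj_ofReal]
  ring

end

/-!
The unit circle separates the zeros of `f(z) = z ^ n + a z ^ k + b conj z ^ k - 1` into two groups,
because `b - a > 2` makes `a z ^ k + b conj z ^ k` dominate there. Inside the disc `b conj z ^ k`
balances the constant and `f` is sense-reversing away from `0`; outside it `b conj z ^ k` balances
`z ^ n`, so that `|z| ^ (n - k) ≥ b - a - 1` at a zero, and the bound `(n + k) a < (n - k) b`, with
some room, is what makes such zeros sense-preserving. Hence no zero is singular, and each one has
order `1` or `-1` because `0` is not a zero. It remains to count `k` zeros inside and `n + k` outside.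

Both counts come from a homotopy instead of the argument principle. For a family of maps without
singular zeros and without zeros on the boundary of a compact set, the implicit function theorem and
compactness make the number of zeros in that set locally constant in the parameter
(`IsCompact.ncard_zeros_eq_of_homotopy`). Inside the disc `f` is deformed to `conj (b z ^ k) - 1`,
which has `k` zeros (`ncard_zeros_closedBall`). In the annulus `1 ≤ |z| ≤ 2 b + 2` it is deformed to
`z ^ n + b conj z ^ k`, whose nonzero roots are the roots of `z ^ (n + k) = - ρ ^ (n + k)` with
`ρ ^ (n - k) = b`, so there are `n + k` of them (`ncard_zeros_annulus`).
-/

open scoped ComplexConjugate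
open Filter Set
open scoped Topology

/-! ### Homotopy invariance of the number of zeros -/

/-- Let `P` define a relation between parameters `x` and points `y` of a compact set `K`. If near
each solution over `x₀` the relation is the graph of a function of `x` continuous at `x₀`, and
near every other point of `K` it fails, then the fibre over `x₀` is finite and nearby fibres have
as many points. Requiring the solutions to be interior to `K` keeps them from leaving it. -/
theorem IsCompact.eventually_ncard_eq {X Y : Type*} [TopologicalSpace X] [TopologicalSpace Y]
    [T2Space Y] {K : Set Y} (hK : IsCompact K) {P : X × Y → Prop} {x₀ : X}
    (hP : ∀ y ∈ K, P (x₀, y) → y ∈ interior K ∧ ∃ ψ : X → Y, Tendsto ψ (𝓝 x₀) (𝓝 y) ∧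
      ∀ᶠ v in 𝓝 (x₀, y), P v ↔ ψ v.1 = v.2)
    (hN : ∀ y ∈ K, ¬ P (x₀, y) → ∀ᶠ v in 𝓝 (x₀, y), ¬ P v) :
    {y ∈ K | P (x₀, y)}.Finite ∧
      ∀ᶠ x in 𝓝 x₀, {y ∈ K | P (x, y)}.ncard = {y ∈ K | P (x₀, y)}.ncard := by
  have hcurve : ∀ y, ∃ ψ : X → Y, y ∈ K → P (x₀, y) → Tendsto ψ (𝓝 x₀) (𝓝 y) ∧
      ∀ᶠ v in 𝓝 (x₀, y), P v ↔ ψ v.1 = v.2 := by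
    intro y
    by_cases h : y ∈ K ∧ P (x₀, y)
    · obtain ⟨ψ, h'⟩ := (hP y h.1 h.2).2
      exact ⟨ψ, fun _ _ => h'⟩
    · exact ⟨fun _ => y, fun h1 h2 => absurd ⟨h1, h2⟩ h⟩
  choose ψ hψ using hcurve
  have hfin : {y ∈ K | P (x₀, y)}.Finite := by
    obtain ⟨s, hsK, hs⟩ := hK.elim_nhds_subcover (fun y => {y' | y ∈ K → P (x₀, y') → y' = y})
      (fun y hy => by
        by_cases h : P (x₀, y)
        · obtain ⟨-, h2⟩ := hψ y hy h
          have h3 : ψ y x₀ = y := h2.self_of_nhds.1 h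
          have h4 : ∀ᶠ y' in 𝓝 y, P (x₀, y') ↔ ψ y x₀ = y' :=
            ((Continuous.prodMk_right x₀).tendsto y).eventually h2
          filter_upwards [h4] with y' h5 _ h6
          rw [← h5.1 h6, h3]
        · have h4 : ∀ᶠ y' in 𝓝 y, ¬ P (x₀, y') :=
            ((Continuous.prodMk_right x₀).tendsto y).eventually (hN y hy h)
          filter_upwards [h4] with y' h5 _ h6
          exact absurd h6 h5)
    refine s.finite_toSet.subset fun y hy => ?_
    obtain ⟨y₀, hy₀, h⟩ := mem_iUnion₂.1 (hs hy.1)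
    rw [h (hsK y₀ hy₀) hy.2]
    exact hy₀
  refine ⟨hfin, ?_⟩
  -- For `x` near `x₀`, the map `y ↦ ψ y x` is a bijection from the fibre over `x₀` to that over `x`.
  have hmem : ∀ᶠ x in 𝓝 x₀, ∀ y ∈ {y ∈ K | P (x₀, y)}, ψ y x ∈ K ∧ P (x, ψ y x) := by
    refine (eventually_all_finite hfin).2 fun y hy => ?_
    obtain ⟨h1, h2⟩ := hψ y hy.1 hy.2
    have h3 : Tendsto (fun x => (x, ψ y x)) (𝓝 x₀) (𝓝 (x₀, y)) := tendsto_id.prodMk_nhds h1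
    filter_upwards [h1.eventually (isOpen_interior.mem_nhds (hP y hy.1 hy.2).1),
      h3.eventually h2] with x h4 h5
    exact ⟨interior_subset h4, h5.2 rfl⟩
  have hinj : ∀ᶠ x in 𝓝 x₀, ∀ y ∈ {y ∈ K | P (x₀, y)}, ∀ y' ∈ {y ∈ K | P (x₀, y)},
      ψ y x = ψ y' x → y = y' := by
    refine (eventually_all_finite hfin).2 fun y hy => (eventually_all_finite hfin).2 fun y' hy' => ?_
    by_cases h : y = y'
    · exact Eventually.of_forall fun _ _ => h
    · have h3 := (hψ y hy.1 hy.2).1.prodMk_nhds (hψ y' hy'.1 hy'.2).1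
      filter_upwards [h3.eventually (isClosed_diagonal.isOpen_compl.mem_nhds h)]
        with x h1 h2
      exact absurd h2 h1
  have hsurj : ∀ᶠ x in 𝓝 x₀, ∀ y ∈ K, P (x, y) → ∃ y₀ ∈ {y ∈ K | P (x₀, y)}, ψ y₀ x = y := by
    refine hK.eventually_forall_of_forall_eventually
      (P := fun x y => P (x, y) → ∃ y₀ ∈ {y ∈ K | P (x₀, y)}, ψ y₀ x = y) fun y hy => ?_
    by_cases h : P (x₀, y)
    · filter_upwards [(hψ y hy h).2] with v h1 h2
      exact ⟨y, ⟨hy, h⟩, h1.1 h2⟩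
    · filter_upwards [hN y hy h] with v h1 h2
      exact absurd h2 h1
  filter_upwards [hmem, hinj, hsurj] with x h1 h2 h3
  have h4 : {y ∈ K | P (x, y)} = (fun y => ψ y x) '' {y ∈ K | P (x₀, y)} := by
    ext y
    constructor
    · rintro ⟨hy, hp⟩
      exact h3 y hy hp
    · rintro ⟨y₀, hy₀, rfl⟩
      exact h1 y₀ hy₀
  rw [h4]
  exact InjOn.ncard_image fun y hy y' hy' h => h2 y hy y' hy' h

/-- Along a homotopy whose zeros in a compact set `K` are interior to `K` and have invertible
derivative in the space variable, the number of zeros in `K` does not change: by the implicit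
function theorem it is locally constant in the parameter. -/
theorem IsCompact.ncard_zeros_eq_of_homotopy {E : Type*} [NormedAddCommGroup E] [NormedSpace ℝ E]
    [CompleteSpace E] {K : Set E} (hK : IsCompact K) {F : ℝ × E → E} (hF : Continuous F)
    (hz : ∀ t ∈ Icc (0 : ℝ) 1, ∀ z ∈ K, F (t, z) = 0 → z ∈ interior K ∧
      ∃ F' : ℝ × E →L[ℝ] E, HasStrictFDerivAt F F' (t, z) ∧
        (F' ∘L .inr ℝ ℝ E).IsInvertible) :
    {z ∈ K | F (1, z) = 0}.Finite ∧
      {z ∈ K | F (1, z) = 0}.ncard = {z ∈ K | F (0, z) = 0}.ncard := by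
  have key : ∀ t ∈ Icc (0 : ℝ) 1, {z ∈ K | F (t, z) = 0}.Finite ∧
      ∀ᶠ s in 𝓝 t, {z ∈ K | F (s, z) = 0}.ncard = {z ∈ K | F (t, z) = 0}.ncard := by
    intro t ht
    refine hK.eventually_ncard_eq (P := fun v => F v = 0) (fun z hzK h => ?_) fun z _ h =>
      hF.continuousAt.eventually_ne h
    obtain ⟨h1, F', h2, h3⟩ := hz t ht z hzK h
    refine ⟨h1, h2.implicitFunctionOfProdDomain h3,
      h2.tendsto_implicitFunctionOfProdDomain h3, ?_⟩
    have h4 := h2.eventually_apply_eq_iff_implicitFunctionOfProdDomain h3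
    rwa [h] at h4
  refine ⟨(key 1 (by simp)).1, ?_⟩
  refine isPreconnected_Icc.constant (s := Icc (0 : ℝ) 1)
    (f := fun t => {z ∈ K | F (t, z) = 0}.ncard) (fun t ht => ?_) (by simp) (by simp)
  refine ContinuousAt.continuousWithinAt
    (continuousAt_const.congr (f := fun _ => {z ∈ K | F (t, z) = 0}.ncard) ?_)
  filter_upwards [(key t ht).2] with s hs using hs.symm

/-- The real-linear map `z ↦ α z + conj (β z)` has determinant `|α|² - |β|²`, so it is invertible
off the critical curve. -/
theorem isInvertible_of_apply_eq_mul_add_conj_mul {α β : ℂ} (h : ‖α‖ ≠ ‖β‖) {L : ℂ →L[ℝ] ℂ}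
    (hL : ∀ z, L z = α * z + conj (β * z)) : L.IsInvertible := by
  have hinj : Function.Injective L := by
    rw [injective_iff_map_eq_zero]
    intro z hz
    rw [hL] at hz
    have h1 : ‖α * z‖ = ‖β * z‖ := by
      rw [eq_neg_of_add_eq_zero_left hz, norm_neg, Complex.norm_conj]
    rw [norm_mul, norm_mul] at h1
    by_contra h2
    exact h (mul_right_cancel₀ (norm_ne_zero_iff.2 h2) h1)
  exact ⟨(LinearEquiv.ofInjectiveEndo (L : ℂ →ₗ[ℝ] ℂ) hinj).toContinuousLinearEquiv, by
    ext z; rfl⟩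

/-- Homotopy invariance of the number of zeros for the harmonic family `u + t v + conj w`,
`0 ≤ t ≤ 1`, with holomorphic `u`, `v`, `w` and no singular zeros in `K`. -/
theorem IsCompact.ncard_zeros_harmonic_eq {K : Set ℂ} (hK : IsCompact K)
    {u v w u' v' w' : ℂ → ℂ} (hu : ∀ z, HasDerivAt u (u' z) z) (hv : ∀ z, HasDerivAt v (v' z) z)
    (hw : ∀ z, HasDerivAt w (w' z) z)
    (hz : ∀ t ∈ Icc (0 : ℝ) 1, ∀ z ∈ K, u z + t * v z + conj (w z) = 0 →
      z ∈ interior K ∧ ‖u' z + t * v' z‖ ≠ ‖w' z‖) :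
    {z ∈ K | u z + v z + conj (w z) = 0}.Finite ∧
      {z ∈ K | u z + v z + conj (w z) = 0}.ncard = {z ∈ K | u z + conj (w z) = 0}.ncard := by
  set F : ℝ × ℂ → ℂ := fun p => u p.2 + p.1 * v p.2 + conj (w p.2) with hF
  have hr : ∀ {g g' : ℂ → ℂ}, (∀ z, HasDerivAt g (g' z) z) →
      ContDiff ℝ 1 fun p : ℝ × ℂ => g p.2 := fun hg =>
    (Differentiable.contDiff fun z => (hg z).differentiableAt).restrict_scalars ℝ |>.comp
      contDiff_snd
  have hFc : ContDiff ℝ 1 F :=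
    ((hr hu).add ((Complex.ofRealCLM.contDiff.comp contDiff_fst).mul (hr hv))).add
      (Complex.conjCLE.contDiff.comp (hr hw))
  have key := hK.ncard_zeros_eq_of_homotopy hFc.continuous (fun t ht z hzK h => by
    obtain ⟨h1, h2⟩ := hz t ht z hzK h
    have hs := hFc.contDiffAt.hasStrictFDerivAt (x := (t, z)) one_ne_zero
    refine ⟨h1, _, hs, isInvertible_of_apply_eq_mul_add_conj_mul h2 fun y => ?_⟩
    have hc : HasFDerivAt (fun z : ℂ => F (t, z)) (fderiv ℝ F (t, z) ∘L .inr ℝ ℝ ℂ) z :=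
      hs.hasFDerivAt.comp z (hasFDerivAt_prodMk_right t z)
    have hd : HasFDerivAt (fun z : ℂ => F (t, z)) _ z :=
      (((hu z).add ((hv z).const_mul (t : ℂ))).hasFDerivAt.restrictScalars ℝ).add
        ((Complex.conjCLE : ℂ →L[ℝ] ℂ).hasFDerivAt.comp z
          ((hw z).hasFDerivAt.restrictScalars ℝ))
    rw [hc.unique hd]
    simp [mul_comm])
  simpa [hF] using key

/-! ### Zeros of the two model maps -/

theorem Complex.ncard_setOf_pow_eq {m : ℕ} (hm : m ≠ 0) {c : ℂ} (hc : c ≠ 0) :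
    {z : ℂ | z ^ m = c}.ncard = m := by
  have hex : ∃ α : ℂ, α ^ m = c := IsAlgClosed.exists_pow_nat_eq c (Nat.pos_of_ne_zero hm)
  have hprim := Complex.isPrimitiveRoot_exp m hm
  have h := hprim.card_nthRoots c
  rw [if_pos hex] at h
  have hset : {z : ℂ | z ^ m = c} = ((Polynomial.nthRoots m c).toFinset : Set ℂ) := by
    ext z
    simp [Polynomial.mem_nthRoots (Nat.pos_of_ne_zero hm)]
  rw [hset, ncard_coe_finset, Multiset.toFinset_card_of_nodup (hprim.nthRoots_nodup hc), h]

/-- Nonzero solutions of `z ^ n + b conj z ^ k = 0` lie on the circle `|z| = ρ`,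
`ρ ^ (n - k) = b`. There, multiplication by `z ^ k` turns the equation into
`z ^ (n + k) = - ρ ^ (n + k)`. -/
theorem ncard_pow_add_conj_pow_eq_zero {n k : ℕ} (hkn : k < n) {b : ℝ} (hb : 0 < b) :
    {z : ℂ | z ≠ 0 ∧ z ^ n + b * conj z ^ k = 0}.ncard = n + k := by
  have hd : n - k ≠ 0 := by omega
  set ρ : ℝ := b ^ (((n - k : ℕ) : ℝ)⁻¹) with hρ
  have hρ0 : 0 < ρ := Real.rpow_pos_of_pos hb _
  have hρb : ρ ^ (n - k) = b := Real.rpow_inv_natCast_pow hb.le hd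
  have hρn : ρ ^ n = b * ρ ^ k := by rw [← hρb, ← pow_add]; congr 1; omega
  have hc : (-(ρ : ℂ) ^ (n + k)) ≠ 0 :=
    neg_ne_zero.2 (pow_ne_zero _ (Complex.ofReal_ne_zero.2 hρ0.ne'))
  rw [← Complex.ncard_setOf_pow_eq (m := n + k) (by omega) hc]
  congr 1
  have hmod : ∀ z : ℂ, ‖z‖ = ρ → z * conj z = (ρ : ℂ) ^ 2 := by
    intro z h
    rw [Complex.mul_conj', h]
  have hnC : (ρ : ℂ) ^ n = b * (ρ : ℂ) ^ k := by exact_mod_cast hρn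
  ext z
  constructor
  · rintro ⟨hz0, hz⟩
    have hr0 : 0 < ‖z‖ := norm_pos_iff.2 hz0
    have h1 : ‖z‖ ^ n = b * ‖z‖ ^ k := by
      have := congrArg norm (eq_neg_of_add_eq_zero_left hz)
      simpa [abs_of_pos hb] using this
    have h2 : ‖z‖ ^ (n - k) = b := by
      refine mul_right_cancel₀ (pow_pos hr0 k).ne' ?_
      rw [← h1, ← pow_add]; congr 1; omega
    have h3 : ‖z‖ = ρ := (pow_left_inj₀ hr0.le hρ0.le hd).1 (h2.trans hρb.symm)
    have h4 : (z * conj z) ^ k = (ρ : ℂ) ^ (2 * k) := by rw [hmod z h3, pow_mul]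
    rw [mul_pow] at h4
    show z ^ (n + k) = _
    rw [pow_add, pow_add, hnC]
    linear_combination z ^ k * hz - (b : ℂ) * h4
  · intro (hz : z ^ (n + k) = _)
    have h3 : ‖z‖ = ρ := by
      have := congrArg norm hz
      rw [norm_neg, norm_pow, norm_pow, Complex.norm_of_nonneg hρ0.le] at this
      exact (pow_left_inj₀ (norm_nonneg _) hρ0.le (by omega)).1 this
    have hz0 : z ≠ 0 := norm_pos_iff.1 (h3 ▸ hρ0)
    have h4 : (z * conj z) ^ k = (ρ : ℂ) ^ (2 * k) := by rw [hmod z h3, pow_mul]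
    rw [mul_pow] at h4
    refine ⟨hz0, mul_left_cancel₀ (pow_ne_zero k hz0) ?_⟩
    rw [pow_add, pow_add, hnC] at hz
    linear_combination hz + (b : ℂ) * h4

/-! ### Location of the zeros and of the critical curve -/

/-! The equation `s z ^ n + α z ^ k + conj (b z ^ k) = τ` with `s, τ ∈ [0, 1]` and `0 ≤ α ≤ a` covers
both deformations used for the count, inside and outside the unit disc. -/

section Estimates

variable {n k : ℕ} {α b s τ : ℝ} {z : ℂ}

theorem sub_mul_norm_pow_le (hα : 0 ≤ α) (hb : 0 ≤ b) (hs : 0 ≤ s) (hτ : 0 ≤ τ)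
    (hz : s * z ^ n + α * z ^ k + conj (b * z ^ k) = τ) :
    (b - α) * ‖z‖ ^ k ≤ s * ‖z‖ ^ n + τ := by
  have h : conj (b * z ^ k) = τ - s * z ^ n - α * z ^ k := by linear_combination hz
  have h1 : b * ‖z‖ ^ k = ‖(τ : ℂ) - s * z ^ n - α * z ^ k‖ := by
    rw [← h, Complex.norm_conj, norm_mul, norm_pow, Complex.norm_of_nonneg hb]
  have h2 := norm_sub_le ((τ : ℂ) - s * z ^ n) (α * z ^ k)
  have h3 := norm_sub_le (τ : ℂ) (s * z ^ n)
  simp only [norm_mul, norm_pow, Complex.norm_of_nonneg, hα, hs, hτ] at h2 h3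
  linarith

theorem norm_ne_one_of_zero (hα : 0 ≤ α) (hb : α + 2 < b) (hs : 0 ≤ s) (hs1 : s ≤ 1)
    (hτ : 0 ≤ τ) (hτ1 : τ ≤ 1) (hz : s * z ^ n + α * z ^ k + conj (b * z ^ k) = τ) :
    ‖z‖ ≠ 1 := by
  intro h
  have h1 := sub_mul_norm_pow_le hα (by linarith) hs hτ hz
  rw [h, one_pow, one_pow] at h1
  linarith

theorem norm_lt_of_zero (hkn : k < n) (hα : 0 ≤ α) (hb : α ≤ b)
    (hτ : 0 ≤ τ) (hτ1 : τ ≤ 1) (hz : z ^ n + α * z ^ k + conj (b * z ^ k) = τ) :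
    ‖z‖ < 2 * b + 2 := by
  by_contra! hr
  have hr1 : 1 ≤ ‖z‖ := by linarith
  have h : z ^ n = τ - α * z ^ k - conj (b * z ^ k) := by linear_combination hz
  have h2 := norm_sub_le ((τ : ℂ) - α * z ^ k) (conj (b * z ^ k))
  have h3 := norm_sub_le (τ : ℂ) (α * z ^ k)
  rw [← h, Complex.norm_conj] at h2
  simp only [norm_mul, norm_pow, Complex.norm_of_nonneg, hα, hα.trans hb, hτ] at h2 h3
  have hk1 : 1 ≤ ‖z‖ ^ k := one_le_pow₀ hr1
  have h4 : ‖z‖ ^ (k + 1) ≤ ‖z‖ ^ n := pow_le_pow_right₀ hr1 hkn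
  rw [pow_succ] at h4
  nlinarith

/-- The nonzero points of the closed unit disc, whether zeros or not, are in the sense-reversing
region. -/
theorem norm_deriv_lt_of_norm_le_one (hk : 1 ≤ k) (hkn : k < n) (hα : 0 ≤ α)
    (hb : α * k + n < b * k) (hs : 0 ≤ s) (hs1 : s ≤ 1) (hz0 : z ≠ 0) (hz1 : ‖z‖ ≤ 1) :
    ‖s * (n * z ^ (n - 1)) + α * (k * z ^ (k - 1))‖ < b * (k * ‖z‖ ^ (k - 1)) := by
  have hr0 : 0 < ‖z‖ := norm_pos_iff.2 hz0
  have h1 := norm_add_le (s * (n * z ^ (n - 1))) (α * (k * z ^ (k - 1)))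
  simp only [norm_mul, norm_pow, Complex.norm_of_nonneg, hα, hs, Complex.norm_natCast] at h1
  have h2 : ‖z‖ ^ (n - 1) ≤ ‖z‖ ^ (k - 1) := pow_le_pow_of_le_one hr0.le hz1 (by omega)
  have h3 : 0 < ‖z‖ ^ (k - 1) := pow_pos hr0 _
  have h4 : s * (n * ‖z‖ ^ (n - 1)) ≤ n * ‖z‖ ^ (k - 1) :=
    (mul_le_of_le_one_left (by positivity) hs1).trans (by gcongr)
  have h5 := mul_lt_mul_of_pos_right hb h3
  linarith

/-- Zeros with `1 ≤ |z|` are in the sense-preserving region. The equation gives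
`|z| ^ (n - k) ≥ b - α - 1`, so `|n z ^ (n - k) + k α| ≥ n (b - α - 1) - k α`, and this exceeds `k b`
exactly under the hypothesis on `(n + k) α`. -/
theorem lt_norm_deriv_of_one_le_norm (hk : 1 ≤ k) (hkn : k < n) (hα : 0 ≤ α)
    (hb0 : 0 ≤ b) (hb : (n + k) * α + n < (n - k) * b) (hτ : 0 ≤ τ) (hτ1 : τ ≤ 1)
    (hz1 : 1 ≤ ‖z‖) (hz : z ^ n + α * z ^ k + conj (b * z ^ k) = τ) :
    b * (k * ‖z‖ ^ (k - 1)) < ‖n * z ^ (n - 1) + α * (k * z ^ (k - 1))‖ := by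
  have hr0 : 0 < ‖z‖ := by linarith
  have h0 := sub_mul_norm_pow_le (s := 1) hα hb0 zero_le_one hτ (by simpa using hz)
  have h1 := norm_sub_le (n * z ^ (n - 1) + α * (k * z ^ (k - 1))) (α * (k * z ^ (k - 1)))
  simp only [add_sub_cancel_right] at h1
  rw [norm_mul (n : ℂ), norm_mul (α : ℂ), norm_mul (k : ℂ), norm_pow, norm_pow,
    Complex.norm_of_nonneg hα, Complex.norm_natCast, Complex.norm_natCast] at h1
  have hk1 : 1 ≤ ‖z‖ ^ k := one_le_pow₀ hz1
  have h2 : (b - α - 1) * ‖z‖ ^ k ≤ ‖z‖ ^ n := by linarith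
  have h3 : (b - α - 1) * ‖z‖ ^ (k - 1) ≤ ‖z‖ ^ (n - 1) := by
    refine le_of_mul_le_mul_right ?_ hr0
    rw [mul_assoc, pow_sub_one_mul (by omega), pow_sub_one_mul (by omega)]
    exact h2
  have h4 := mul_le_mul_of_nonneg_left h3 (Nat.cast_nonneg (α := ℝ) n)
  have h5 := mul_lt_mul_of_pos_right hb (pow_pos hr0 (k - 1))
  linarith

end Estimates

/-! ### Order of a nonsingular zero -/

theorem firstNonvanishingDeriv_eq_one {u : ℂ → ℂ} {z : ℂ} (h : deriv u z ≠ 0) :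
    firstNonvanishingDeriv u z = 1 := by
  have hmem : 1 ∈ {m : ℕ | 1 ≤ m ∧ iteratedDeriv m u z ≠ 0} := ⟨le_rfl, by simpa using h⟩
  exact le_antisymm (Nat.sInf_le hmem) (Nat.sInf_mem ⟨1, hmem⟩).1

/-- A nonsingular point at which `g'` does not vanish counts with multiplicity one on either side of
the critical curve. -/
theorem natAbs_zeroOrder_eq_one {h g : ℂ → ℂ} {z : ℂ} (hz : z ∉ criticalCurve h g)
    (hg : deriv g z ≠ 0) : (zeroOrder h g z).natAbs = 1 := by
  by_cases h1 : z ∈ sensePreservingRegion h g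
  · have : deriv h z ≠ 0 := norm_pos_iff.1 ((norm_nonneg _).trans_lt h1)
    simp [zeroOrder, h1, firstNonvanishingDeriv_eq_one this]
  · have h2 : z ∈ senseReversingRegion h g := lt_of_le_of_ne (not_lt.1 h1) hz
    simp [zeroOrder, h1, h2, firstNonvanishingDeriv_eq_one hg]

/-! ### Zeros inside and outside the unit circle -/

/-- In the unit disc, `-1 + t (z ^ n + a z ^ k) + conj (b z ^ k)` deforms the map to
`conj (b z ^ k) - 1`. -/
theorem ncard_zeros_closedBall {n k : ℕ} {a b : ℝ} (hk : 1 ≤ k) (hkn : k < n) (ha : 0 ≤ a)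
    (hab : a + 2 < b) (hb : a * k + n < b * k) :
    {z ∈ Metric.closedBall (0 : ℂ) 1 |
      harmonicMap (analyticPart n k a) (coanalyticPart k b) z = 0}.Finite ∧
    {z ∈ Metric.closedBall (0 : ℂ) 1 |
      harmonicMap (analyticPart n k a) (coanalyticPart k b) z = 0}.ncard = k := by
  have hb0 : 0 < b := by linarith
  have key := (isCompact_closedBall (0 : ℂ) 1).ncard_zeros_harmonic_eq
    (v := fun z => z ^ n + a * z ^ k) (fun z => hasDerivAt_const z (-1))
    (fun z => (hasDerivAt_pow n z).add ((hasDerivAt_pow k z).const_mul (a : ℂ)))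
    (fun z => (hasDerivAt_pow k z).const_mul (b : ℂ)) (by
      intro t ht z hzK hz
      rw [mem_closedBall_zero_iff] at hzK
      have hta : 0 ≤ t * a := mul_nonneg ht.1 ha
      have hta' : t * a ≤ a := mul_le_of_le_one_left ha ht.2
      have hz' : (t : ℂ) * z ^ n + (t * a : ℝ) * z ^ k + conj (b * z ^ k) = (1 : ℝ) := by
        push_cast
        linear_combination hz
      have hz0 : z ≠ 0 := by
        rintro rfl
        simp [show k ≠ 0 by omega, show n ≠ 0 by omega] at hz
      constructor
      · rw [interior_closedBall _ one_ne_zero, mem_ball_zero_iff]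
        exact lt_of_le_of_ne hzK (norm_ne_one_of_zero hta (by linarith) ht.1 ht.2 zero_le_one
          le_rfl hz')
      · have h1 := norm_deriv_lt_of_norm_le_one (b := b) hk hkn hta
          (by nlinarith [Nat.cast_nonneg (α := ℝ) k]) ht.1 ht.2 hz0 hzK
        rw [norm_mul (b : ℂ), norm_mul (k : ℂ), norm_pow, Complex.norm_of_nonneg hb0.le,
          Complex.norm_natCast]
        refine (lt_of_eq_of_lt ?_ h1).ne
        congr 1
        push_cast
        ring)
  have hfun : ∀ z : ℂ, -1 + (z ^ n + a * z ^ k) + conj ((b : ℂ) * z ^ k) =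
      harmonicMap (analyticPart n k a) (coanalyticPart k b) z := fun z => by
    rw [harmonicMap, analyticPart, coanalyticPart]
    ring
  have hset : {z ∈ Metric.closedBall (0 : ℂ) 1 | (-1 : ℂ) + conj ((b : ℂ) * z ^ k) = 0} =
      {z : ℂ | z ^ k = (b : ℂ)⁻¹} := by
    have hbC : (b : ℂ) ≠ 0 := Complex.ofReal_ne_zero.2 hb0.ne'
    ext z
    have h1 : (-1 : ℂ) + conj ((b : ℂ) * z ^ k) = 0 ↔ z ^ k = (b : ℂ)⁻¹ := by
      rw [neg_add_eq_zero, eq_comm, ← (starRingEnd ℂ).injective.eq_iff, Complex.conj_conj, map_one,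
        ← mul_right_inj' hbC (c := (b : ℂ)⁻¹), mul_inv_cancel₀ hbC]
    simp only [mem_ofPred_eq, h1, and_iff_right_iff_imp, mem_closedBall_zero_iff]
    intro h
    have h2 := congrArg norm h
    rw [norm_pow, norm_inv, Complex.norm_of_nonneg hb0.le] at h2
    exact (pow_le_one_iff_of_nonneg (norm_nonneg z) (by omega)).1
      (h2 ▸ inv_le_one_of_one_le₀ (by linarith))
  rw [hset, Complex.ncard_setOf_pow_eq (by omega)
    (inv_ne_zero (Complex.ofReal_ne_zero.2 hb0.ne'))] at key
  simpa only [hfun] using key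

/-- Outside the unit disc, `z ^ n + t (a z ^ k - 1) + conj (b z ^ k)` deforms the map to
`z ^ n + conj (b z ^ k)`. No zero of this family reaches the radius `2 b + 2`. -/
theorem ncard_zeros_annulus {n k : ℕ} {a b : ℝ} (hk : 1 ≤ k) (hkn : k < n) (ha : 0 ≤ a)
    (hab : a + 2 < b) (hb : (n + k) * a + n < (n - k) * b) :
    {z ∈ {z : ℂ | 1 ≤ ‖z‖ ∧ ‖z‖ ≤ 2 * b + 2} |
      harmonicMap (analyticPart n k a) (coanalyticPart k b) z = 0}.Finite ∧
    {z ∈ {z : ℂ | 1 ≤ ‖z‖ ∧ ‖z‖ ≤ 2 * b + 2} |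
      harmonicMap (analyticPart n k a) (coanalyticPart k b) z = 0}.ncard = n + k := by
  have hb0 : 0 < b := by linarith
  have hK : IsCompact {z : ℂ | 1 ≤ ‖z‖ ∧ ‖z‖ ≤ 2 * b + 2} := by
    refine (isCompact_closedBall (0 : ℂ) (2 * b + 2)).of_isClosed_subset ?_
      fun z hz => mem_closedBall_zero_iff.2 hz.2
    exact (isClosed_le continuous_const continuous_norm).inter
      (isClosed_le continuous_norm continuous_const)
  have key := hK.ncard_zeros_harmonic_eq (fun z => hasDerivAt_pow n z)
    (fun z => ((hasDerivAt_pow k z).const_mul (a : ℂ)).sub_const 1)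
    (fun z => (hasDerivAt_pow k z).const_mul (b : ℂ)) (by
      intro t ht z hzK hz
      have hta : 0 ≤ t * a := mul_nonneg ht.1 ha
      have hta' : t * a ≤ a := mul_le_of_le_one_left ha ht.2
      have hz' : z ^ n + (t * a : ℝ) * z ^ k + conj (b * z ^ k) = (t : ℝ) := by
        push_cast
        linear_combination hz
      constructor
      · have hopen : IsOpen {z : ℂ | 1 < ‖z‖ ∧ ‖z‖ < 2 * b + 2} :=
          (isOpen_lt continuous_const continuous_norm).inter
            (isOpen_lt continuous_norm continuous_const)
        have hsub : {z : ℂ | 1 < ‖z‖ ∧ ‖z‖ < 2 * b + 2} ⊆ {z : ℂ | 1 ≤ ‖z‖ ∧ ‖z‖ ≤ 2 * b + 2} :=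
          fun y hy => ⟨hy.1.le, hy.2.le⟩
        refine interior_maximal hsub hopen ⟨?_, ?_⟩
        · exact lt_of_le_of_ne hzK.1 (norm_ne_one_of_zero (b := b) (n := n) (s := 1) hta
            (by linarith) zero_le_one le_rfl ht.1 ht.2 (by simpa using hz')).symm
        · exact norm_lt_of_zero hkn hta (by linarith) ht.1 ht.2 hz'
      · have h1 := lt_norm_deriv_of_one_le_norm (b := b) hk hkn hta hb0.le
          (by nlinarith [Nat.cast_nonneg (α := ℝ) k, Nat.cast_nonneg (α := ℝ) n])
          ht.1 ht.2 hzK.1 hz'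
        rw [norm_mul (b : ℂ), norm_mul (k : ℂ), norm_pow, Complex.norm_of_nonneg hb0.le,
          Complex.norm_natCast]
        refine (h1.trans_eq ?_).ne'
        congr 1
        push_cast
        ring)
  have hfun : ∀ z : ℂ, z ^ n + (a * z ^ k - 1) + conj ((b : ℂ) * z ^ k) =
      harmonicMap (analyticPart n k a) (coanalyticPart k b) z := fun z => by
    rw [harmonicMap, analyticPart, coanalyticPart]
    ring
  have hset : {z ∈ {z : ℂ | 1 ≤ ‖z‖ ∧ ‖z‖ ≤ 2 * b + 2} | z ^ n + conj ((b : ℂ) * z ^ k) = 0} =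
      {z : ℂ | z ≠ 0 ∧ z ^ n + b * conj z ^ k = 0} := by
    ext z
    simp only [mem_ofPred_eq, map_mul, map_pow, Complex.conj_ofReal]
    refine ⟨fun h => ⟨norm_pos_iff.1 (by linarith [h.1.1]), h.2⟩, fun h => ⟨?_, h.2⟩⟩
    have h1 : z ^ n + (0 : ℝ) * z ^ k + conj (b * z ^ k) = (0 : ℝ) := by simpa using h.2
    refine ⟨?_, (norm_lt_of_zero hkn le_rfl hb0.le le_rfl zero_le_one h1).le⟩
    by_contra! hlt
    have h2 := sub_mul_norm_pow_le (s := 1) le_rfl hb0.le zero_le_one le_rfl (by simpa using h1)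
    have h3 : ‖z‖ ^ n ≤ ‖z‖ ^ k := pow_le_pow_of_le_one (norm_nonneg _) hlt.le hkn.le
    have h4 : 0 < ‖z‖ ^ k := pow_pos (norm_pos_iff.2 h.1) k
    nlinarith
  rw [hset, ncard_pow_add_conj_pow_eq_zero hkn hb0] at key
  simpa only [hfun] using key

theorem deriv_analyticPart (n k : ℕ) (a : ℝ) (z : ℂ) :
    deriv (analyticPart n k a) z = n * z ^ (n - 1) + a * (k * z ^ (k - 1)) := by
  have h := (((hasDerivAt_pow n z).add ((hasDerivAt_pow k z).const_mul (a : ℂ))).sub_const 1)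
  exact h.deriv

theorem deriv_coanalyticPart (k : ℕ) (b : ℝ) (z : ℂ) :
    deriv (coanalyticPart k b) z = b * (k * z ^ (k - 1)) :=
  ((hasDerivAt_pow k z).const_mul (b : ℂ)).deriv

/-- The count of zeros under explicit inequalities: `hab` keeps zeros off the unit circle, `hin`
and `hout` keep the zeros inside and outside it off the critical curve. -/
theorem hasExactlyZeros_of_lt {n k : ℕ} {a b : ℝ} (hk : 1 ≤ k) (hkn : k < n) (ha : 0 ≤ a)
    (hab : a + 2 < b) (hin : a * k + n < b * k) (hout : (n + k) * a + n < (n - k) * b) :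
    HasExactlyZeros (analyticPart n k a) (coanalyticPart k b) (n + 2 * k) := by
  have hb0 : 0 < b := by linarith
  have heq : ∀ z, harmonicMap (analyticPart n k a) (coanalyticPart k b) z = 0 →
      z ^ n + a * z ^ k + conj (b * z ^ k) = (1 : ℝ) := by
    intro z hz
    rw [harmonicMap, analyticPart, coanalyticPart] at hz
    push_cast
    linear_combination hz
  have hne0 : ∀ z, harmonicMap (analyticPart n k a) (coanalyticPart k b) z = 0 → z ≠ 0 := by
    rintro z hz rfl
    simp [harmonicMap_parts, show k ≠ 0 by omega, show n ≠ 0 by omega] at hz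
  have hcrit : ∀ z, harmonicMap (analyticPart n k a) (coanalyticPart k b) z = 0 →
      z ∉ criticalCurve (analyticPart n k a) (coanalyticPart k b) := by
    intro z hz h
    have hnorm : ‖deriv (coanalyticPart k b) z‖ = b * (k * ‖z‖ ^ (k - 1)) := by
      simp [deriv_coanalyticPart, abs_of_pos hb0]
    rw [criticalCurve, mem_ofPred_eq, hnorm, deriv_analyticPart] at h
    rcases le_total ‖z‖ 1 with h1 | h1
    · have := norm_deriv_lt_of_norm_le_one (s := 1) hk hkn ha hin zero_le_one le_rfl (hne0 z hz) h1
      rw [Complex.ofReal_one, one_mul] at this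
      exact this.ne h
    · exact (lt_norm_deriv_of_one_le_norm hk hkn ha hb0.le hout zero_le_one le_rfl h1
        (heq z hz)).ne' h
  obtain ⟨hfin₁, hcard₁⟩ := ncard_zeros_closedBall hk hkn ha hab hin
  obtain ⟨hfin₂, hcard₂⟩ := ncard_zeros_annulus hk hkn ha hab hout
  have hunion : {z : ℂ | harmonicMap (analyticPart n k a) (coanalyticPart k b) z = 0} =
      {z ∈ Metric.closedBall (0 : ℂ) 1 |
        harmonicMap (analyticPart n k a) (coanalyticPart k b) z = 0} ∪
      {z ∈ {z : ℂ | 1 ≤ ‖z‖ ∧ ‖z‖ ≤ 2 * b + 2} |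
        harmonicMap (analyticPart n k a) (coanalyticPart k b) z = 0} := by
    ext z
    refine ⟨fun hz => ?_, fun hz => hz.elim And.right And.right⟩
    rcases le_total ‖z‖ 1 with h1 | h1
    · exact .inl ⟨mem_closedBall_zero_iff.2 h1, hz⟩
    · exact .inr ⟨⟨h1, (norm_lt_of_zero hkn ha (by linarith) zero_le_one le_rfl (heq z hz)).le⟩, hz⟩
  have hfin : {z : ℂ | harmonicMap (analyticPart n k a) (coanalyticPart k b) z = 0}.Finite :=
    hunion ▸ hfin₁.union hfin₂
  refine ⟨hfin, hcrit, ?_⟩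
  have hord : ∀ z ∈ hfin.toFinset,
      (zeroOrder (analyticPart n k a) (coanalyticPart k b) z).natAbs = 1 := by
    intro z hz
    have hz' := hfin.mem_toFinset.1 hz
    refine natAbs_zeroOrder_eq_one (hcrit z hz') ?_
    rw [deriv_coanalyticPart]
    exact mul_ne_zero (Complex.ofReal_ne_zero.2 hb0.ne')
      (mul_ne_zero (Nat.cast_ne_zero.2 (by omega)) (pow_ne_zero _ (hne0 z hz')))
  rw [Finset.sum_congr rfl hord, Finset.sum_const, smul_eq_mul, mul_one,
    ← ncard_eq_toFinset_card _ hfin, hunion, ncard_union_eq ?_ hfin₁ hfin₂, hcard₁, hcard₂]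
  · ring
  · refine disjoint_left.2 fun z h1 h2 => ?_
    exact norm_ne_one_of_zero (s := 1) ha hab zero_le_one le_rfl zero_le_one le_rfl
      (by simpa using heq z h1.2) (le_antisymm (mem_closedBall_zero_iff.1 h1.1) h2.1.1)

theorem theorem1 (n k : ℕ) (hk : 1 ≤ k) (hkn : k < n) (ε : ℝ) (hε : 0 < ε) :
    ∃ b₀ : ℝ, ∀ b : ℝ, b₀ < b → ∀ a : ℝ, 0 < a →
      a < (((n : ℝ) - (k : ℝ)) / ((n : ℝ) + (k : ℝ)) - ε) * b →
      HasExactlyZeros (analyticPart n k a) (coanalyticPart k b) (n + 2 * k) := by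
  refine ⟨max (n * (n + k)) ε⁻¹, fun b hb a ha hab => ?_⟩
  obtain ⟨hb1, hb2⟩ := max_lt_iff.1 hb
  have hk' : (1 : ℝ) ≤ k := by exact_mod_cast hk
  have hn' : (2 : ℝ) ≤ n := by exact_mod_cast (show 2 ≤ n by omega)
  have hεb : 1 < ε * b := by rwa [inv_lt_iff_one_lt_mul₀' hε] at hb2
  have hnk : (0 : ℝ) < n + k := by linarith
  -- The slack `ε b > 1` in the hypothesis on `a` absorbs the constant term of `f`.
  have hlin : (n + k) * a < (n - k) * b - (n + k) * (ε * b) := by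
    have := mul_lt_mul_of_pos_left hab hnk
    have h2 : ((n : ℝ) + k) * ((((n : ℝ) - k) / (n + k) - ε) * b) =
        (n - k) * b - (n + k) * (ε * b) := by
      field_simp
    rwa [h2] at this
  have hout : (n + k) * a + n < (n - k) * b := by nlinarith
  -- `(n + k) (b - a) > 2 k b ≥ 2 b`, and `b > n (n + k)`.
  have hgap : n < b - a := by
    have h3 : (n + k) * (n : ℝ) < (n + k) * (b - a) := by nlinarith
    exact lt_of_mul_lt_mul_left h3 hnk.le
  exact hasExactlyZeros_of_lt hk hkn ha.le (by linarith) (by nlinarith) hout
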